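/- **Setting.** Let $d\ge 1$ and let $P$ be the uniform distribution on the Euclidean ball of radius $\sqrt{d+2}$ centred at the origin of $\mathbb R^d$. Let $\theta_\star\in\mathbb R^d$ with $\|\theta_\star\|=1$, let $f_\star(x)=\langle x,\theta_\star\rangle$, and let $0\le L<1$. Let $x_1,\dots,x_n,\tilde x$ be i.i.d. with law $P$ and $y_i=f_\star(x_i)$. Let $\theta_n$ be a minimizer of the empirical risk $\frac1n\sum_{i=1}^n(\langle x_i,\theta\rangle-y_i)^2$ over $\|\theta\|\le L$, chosen as an (arbitrary) measurable function of the training sample, and let $f_n(x)=\langle x,\theta_n\rangle$. For a point $x$ let $N(x)$ be a nearest neighbour of $x$ among $x_1,\dots,x_n$ in Euclidean distance (ties broken in an arbitrary measurable way). The ResMem predictor is $$f_n^{\mathrm{ResMem}}(x)=f_n(x)+\bigl(f_\star(N(x))-f_n(N(x))\bigr).$$ **Theorem.** 1. There is a universal constant $C>0$, independent of $d$, $n$, $L$, $\theta_\star$ and of the choices of minimizers and nearest neighbours, such that for all $d\ge1$, $n\ge2$, $0\le L<1$ and $\|\theta_\star\|=1$ the squared test error is integrable and $$\mathbb E\bigl[f_n^{\mathrm{ResMem}}(\tilde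 x)-f_\star(\tilde x)\bigr]^2\le C\left(d^2L^2n^{-2/3}+d^2(1-L)^2\left[\frac{\log\left(n^{1/d}\right)}{n}\right]^{1/d}\right).$$ 2. For fixed $d\ge 1$ and $0\le L<1$ the right-hand side tends to $0$ as $n\to\infty$. 3. By contrast, the base predictor alone has an irreducible error: for fixed $d\ge1$, $0\le L<1$ and $\|\theta_\star\|=1$, its squared test error is integrable with $\mathbb E[f_n(\tilde x)-f_\star(\tilde x)]^2\ge(1-L)^2>0$ for every $n\ge1$, and $\mathbb E[f_n(\tilde x)-f_\star(\tilde x)]^2\to(1-L)^2$ as $n\to\infty$. -/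

import Mathlib

open MeasureTheory Filter Topology

noncomputable section

namespace ResMem

/-- The Euclidean space `ℝ^d`. -/
abbrev E (d : ℕ) : Type := EuclideanSpace ℝ (Fin d)

/-- The covariate law: uniform distribution on the Euclidean ball of radius `√(d+2)` centred at the
origin of `ℝ^d`. -/
def covariateLaw (d : ℕ) : Measure (E d) :=
  ProbabilityTheory.cond volume (Metric.closedBall (0 : E d) (Real.sqrt ((d : ℝ) + 2)))

/-- The joint law of `n` i.i.d. training covariates and an independent test covariate, all
distributed according to `covariateLaw d`. -/
def sampleLaw (d n : ℕ) : Measure ((Fin n → E d) × E d) :=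
  (Measure.pi fun _ : Fin n => covariateLaw d).prod (covariateLaw d)

/-- The linear function `x ↦ ⟨x, θ⟩`. -/
def linearFn {d : ℕ} (θ x : E d) : ℝ := inner ℝ x θ

/-- The empirical risk `(1/n) ∑ᵢ (⟨xᵢ, θ⟩ - yᵢ)²`. -/
def empiricalRisk {d n : ℕ} (X : Fin n → E d) (y : Fin n → ℝ) (θ : E d) : ℝ :=
  (1 / (n : ℝ)) * ∑ i, (linearFn θ (X i) - y i) ^ 2

/-- `θhat` maps every training sample `x₁, …, xₙ`, labelled by `yᵢ = ⟨xᵢ, θstar⟩`, to a minimizer of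
the empirical risk over the ball `‖θ‖ ≤ L` (an arbitrary one where it is not unique), and it does so
measurably. -/
structure IsERM {d n : ℕ} (L : ℝ) (θstar : E d) (θhat : (Fin n → E d) → E d) : Prop where
  measurable : Measurable θhat
  norm_le : ∀ X, ‖θhat X‖ ≤ L
  isMin : ∀ X θ, ‖θ‖ ≤ L →
    empiricalRisk X (fun i => linearFn θstar (X i)) (θhat X) ≤
      empiricalRisk X (fun i => linearFn θstar (X i)) θ

/-- `N X x` is a point of the training sample `X` nearest to `x` (an arbitrary one in case of ties),
chosen measurably. -/
structure IsNearestNeighborRule {d n : ℕ} (N : (Fin n → E d) → E d → E d) : Prop where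
  measurable : Measurable fun p : (Fin n → E d) × E d => N p.1 p.2
  mem : ∀ X x, ∃ i, N X x = X i
  nearest : ∀ X x i, ‖N X x - x‖ ≤ ‖X i - x‖

/-- The base prediction `f_n(x) = ⟨x, θ_n⟩`. -/
def basePrediction {d n : ℕ} (θhat : (Fin n → E d) → E d) (X : Fin n → E d) (x : E d) : ℝ :=
  linearFn (θhat X) x

/-- The ResMem prediction: base prediction at `x` plus the residual of the base predictor at the
nearest training neighbour of `x`. -/
def resMemPrediction {d n : ℕ} (θstar : E d) (θhat : (Fin n → E d) → E d)
    (N : (Fin n → E d) → E d → E d) (X : Fin n → E d) (x : E d) : ℝ :=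
  basePrediction θhat X x +
    (linearFn θstar (N X x) - basePrediction θhat X (N X x))

/-- The squared error at the test point of a prediction rule `f` trained on the training sample. -/
def sqError {d n : ℕ} (θstar : E d) (f : (Fin n → E d) → E d → ℝ)
    (p : (Fin n → E d) × E d) : ℝ :=
  (f p.1 p.2 - linearFn θstar p.2) ^ 2

/-- The risk: expected squared test error, over the training sample and the test point. -/
def risk {d n : ℕ} (θstar : E d) (f : (Fin n → E d) → E d → ℝ) : ℝ :=
  ∫ p, sqError θstar f p ∂(sampleLaw d n)

/-- The rate `d² L² n^{-2/3} + d² (1-L)² [log(n^{1/d}) / n]^{1/d}`. -/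
def rate (d n : ℕ) (L : ℝ) : ℝ :=
  (d : ℝ) ^ 2 * L ^ 2 * (n : ℝ) ^ (-(2 / 3) : ℝ) +
    (d : ℝ) ^ 2 * (1 - L) ^ 2 *
      (Real.log ((n : ℝ) ^ (1 / (d : ℝ))) / (n : ℝ)) ^ (1 / (d : ℝ))

end ResMem

end

/-! The radius `√(d+2)` is exactly what makes the covariance of the uniform law the identity. Hence
the population risk of θ is ‖θ - θ⋆‖², whose minimizer over the ball of radius L is Lθ⋆, with excess
(1-L)².

The ResMem error at x̃ equals ⟨x̃ - N(x̃), θₙ - θ⋆⟩, so Cauchy–Schwarz bounds it by the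
nearest-neighbour distance times ‖θₙ - θ⋆‖. Two estimates then suffice. `IsERM.norm_sub_le` gives
‖θₙ - Lθ⋆‖ ≤ 2L‖w‖ for every sample, where w = (Σₙ - I)θ⋆, and `integral_momentFluctuation_sq_le`
gives E‖w‖² ≤ (d+2)/n. `IsNearestNeighborRule.integral_norm_sub_sq_le_rpow` bounds the mean squared
neighbour distance, using that small balls around support points carry mass at least t^d.

For the base predictor the risk is exactly E‖θₙ - θ⋆‖². The norm constraint bounds it below by
(1-L)², and the same estimate on θₙ - Lθ⋆ shows that this value is the limit. -/

namespace ResMem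

open ProbabilityTheory

/-! ### Moments and small-ball mass of the uniform law on the ball -/

section Geometry

/-- The radius of the support of `covariateLaw d`. -/
noncomputable def radius (d : ℕ) : ℝ := Real.sqrt ((d : ℝ) + 2)

lemma radius_pos (d : ℕ) : 0 < radius d := Real.sqrt_pos.2 (by positivity)

lemma radius_sq (d : ℕ) : radius d ^ 2 = (d : ℝ) + 2 := Real.sq_sqrt (by positivity)

lemma covariateLaw_eq (d : ℕ) :
    covariateLaw d = (volume (Metric.closedBall (0 : E d) (radius d)))⁻¹ •
      volume.restrict (Metric.closedBall (0 : E d) (radius d)) := rfl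

lemma volume_closedBall_ne_zero {d : ℕ} (c : E d) {r : ℝ} (hr : 0 < r) :
    volume (Metric.closedBall c r) ≠ 0 := (Metric.measure_closedBall_pos volume c hr).ne'

instance (d : ℕ) : IsProbabilityMeasure (covariateLaw d) :=
  cond_isProbabilityMeasure_of_finite (volume_closedBall_ne_zero 0 (radius_pos d))
    measure_closedBall_lt_top.ne

instance (d n : ℕ) : IsProbabilityMeasure (sampleLaw d n) := by
  unfold sampleLaw; infer_instance

lemma ae_norm_le_radius (d : ℕ) : ∀ᵐ x ∂covariateLaw d, ‖x‖ ≤ radius d := by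
  have := ae_cond_mem (μ := (volume : Measure (E d))) (s := Metric.closedBall 0 (radius d))
    Metric.isClosed_closedBall.measurableSet
  filter_upwards [this] with x hx using by simpa using hx

lemma measurePreserving_covariateLaw {d : ℕ} (e : E d ≃ₗᵢ[ℝ] E d) :
    MeasurePreserving e (covariateLaw d) (covariateLaw d) := by
  rw [covariateLaw_eq]
  have h := (e.measurePreserving.restrict_preimage
    (Metric.isClosed_closedBall (x := (0 : E d)) (ε := radius d)).measurableSet)
  have h2 : e ⁻¹' Metric.closedBall 0 (radius d) = Metric.closedBall 0 (radius d) := by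
    ext x; simp
  rw [h2] at h
  exact h.smul_measure _

/-- In polar coordinates the mean of ‖x‖² on a ball of radius R is d R²/(d+2); here R² = d+2. -/
lemma integral_norm_sq_covariateLaw {d : ℕ} (hd : 1 ≤ d) :
    ∫ x, ‖x‖ ^ 2 ∂covariateLaw d = d := by
  have : Nonempty (Fin d) := ⟨⟨0, hd⟩⟩
  have hR := radius_pos d
  rw [covariateLaw_eq, integral_smul_measure,
    ← integral_indicator Metric.isClosed_closedBall.measurableSet]
  have h1 : (fun x : E d => (Metric.closedBall 0 (radius d)).indicator (fun x => ‖x‖ ^ 2) x) =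
      fun x => (Set.Iic (radius d)).indicator (fun r : ℝ => r ^ 2) ‖x‖ := by
    ext x
    by_cases hx : ‖x‖ ≤ radius d <;> simp [Set.indicator, hx]
  have h2 : ∫ y in Set.Ioi (0 : ℝ), y ^ (d - 1) • (Set.Iic (radius d)).indicator
      (fun r : ℝ => r ^ 2) y = radius d ^ (d + 2) / (d + 2) := by
    have : (fun y : ℝ => y ^ (d - 1) • (Set.Iic (radius d)).indicator (fun r : ℝ => r ^ 2) y) =
        (Set.Iic (radius d)).indicator (fun y : ℝ => y ^ (d + 1)) := by
      ext y
      by_cases hy : y ≤ radius d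
      · simp only [Set.indicator, Set.mem_Iic, hy, if_true, smul_eq_mul]
        rw [← pow_add]; congr 1; omega
      · simp [Set.indicator, hy]
    rw [this, setIntegral_indicator measurableSet_Iic, Set.Ioi_inter_Iic,
      ← intervalIntegral.integral_of_le hR.le, integral_pow]
    push_cast
    simp; ring
  rw [h1, integral_fun_norm_addHaar, finrank_euclideanSpace_fin, h2,
    ENNReal.toReal_inv, Measure.addHaar_closedBall _ _ hR.le, finrank_euclideanSpace_fin,
    ENNReal.toReal_mul, ENNReal.toReal_ofReal (by positivity), Measure.real, smul_eq_mul,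
    nsmul_eq_mul, smul_eq_mul]
  have hv : (volume (Metric.ball (0 : E d) 1)).toReal ≠ 0 :=
    (ENNReal.toReal_pos (Metric.measure_ball_pos volume _ one_pos).ne' measure_ball_lt_top.ne).ne'
  rw [pow_add, radius_sq]
  have : radius d ^ d ≠ 0 := by positivity
  field_simp

lemma integrable_of_bound_radius {d : ℕ} {f : E d → ℝ} (hf : Measurable f) (C : ℝ)
    (h : ∀ x, ‖x‖ ≤ radius d → |f x| ≤ C) : Integrable f (covariateLaw d) :=
  Integrable.of_bound hf.aestronglyMeasurable C
    ((ae_norm_le_radius d).mono fun x hx => h x hx)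

lemma integrable_inner_mul_inner {d : ℕ} (a b : E d) :
    Integrable (fun x => inner ℝ x a * inner ℝ x b) (covariateLaw d) := by
  refine integrable_of_bound_radius (by fun_prop) (radius d * ‖a‖ * (radius d * ‖b‖)) fun x hx => ?_
  rw [abs_mul]
  have := radius_pos d
  gcongr <;> exact (abs_real_inner_le_norm _ _).trans (by gcongr)

/-- Rotational invariance: the reflection in the hyperplane orthogonal to a - b swaps the two
vectors and preserves the law. -/
lemma integral_inner_sq_eq_of_norm_eq {d : ℕ} {a b : E d} (h : ‖a‖ = ‖b‖) :
    ∫ x, inner ℝ x a ^ 2 ∂covariateLaw d = ∫ x, inner ℝ x b ^ 2 ∂covariateLaw d := by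
  set e := (ℝ ∙ (a - b))ᗮ.reflection with he
  have hab : e a = b := Submodule.reflection_sub h
  rw [← (measurePreserving_covariateLaw e).integral_comp e.toHomeomorph.measurableEmbedding
    (fun x => inner ℝ x b ^ 2)]
  simp_rw [← hab, e.inner_map_map]

/-- By isotropy each of the d basis directions, scaled to length ‖a‖, contributes the same second
moment, and together they sum to ‖a‖² E‖x‖² = ‖a‖² d. -/
lemma integral_inner_sq {d : ℕ} (hd : 1 ≤ d) (a : E d) :
    ∫ x, inner ℝ x a ^ 2 ∂covariateLaw d = ‖a‖ ^ 2 := by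
  have hd0 : (d : ℝ) ≠ 0 := by positivity
  have hb : ∀ i : Fin d, ‖a‖ = ‖‖a‖ • (EuclideanSpace.basisFun (Fin d) ℝ i)‖ := by
    intro i; simp [norm_smul]
  have h1 : ∑ i : Fin d, ∫ x, inner ℝ x (‖a‖ • (EuclideanSpace.basisFun (Fin d) ℝ i)) ^ 2
      ∂covariateLaw d = ‖a‖ ^ 2 * d := by
    rw [← integral_finsetSum]
    · rw [← integral_norm_sq_covariateLaw hd, ← integral_const_mul]
      congr 1 with x
      rw [← (EuclideanSpace.basisFun (Fin d) ℝ).sum_sq_inner_left x, Finset.mul_sum]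
      refine Finset.sum_congr rfl fun i _ => ?_
      rw [inner_smul_right, mul_pow]
    · intro i _
      simpa only [sq] using integrable_inner_mul_inner _ _
  simp_rw [← integral_inner_sq_eq_of_norm_eq (hb _)] at h1
  simp only [Finset.sum_const, Finset.card_univ, Fintype.card_fin, nsmul_eq_mul] at h1
  exact mul_left_cancel₀ hd0 (h1.trans (mul_comm _ _))

/-- The covariates have identity covariance. -/
lemma integral_inner_mul_inner {d : ℕ} (hd : 1 ≤ d) (a b : E d) :
    ∫ x, inner ℝ x a * inner ℝ x b ∂covariateLaw d = inner ℝ a b := by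
  -- Polarization of the quadratic identity.
  have h := integral_inner_sq hd (a + b)
  have h3 : ∫ x, inner ℝ x (a + b) ^ 2 ∂covariateLaw d =
      ∫ x, ((inner ℝ x a * inner ℝ x a + inner ℝ x b * inner ℝ x b) +
        2 * (inner ℝ x a * inner ℝ x b)) ∂covariateLaw d := by
    congr 1 with x; rw [inner_add_right]; ring
  rw [h3, integral_add, integral_add (integrable_inner_mul_inner _ _)
    (integrable_inner_mul_inner _ _), integral_const_mul] at h
  · simp only [← sq] at h
    rw [integral_inner_sq hd, integral_inner_sq hd, norm_add_sq_real] at h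
    linarith
  · exact (integrable_inner_mul_inner _ _).add (integrable_inner_mul_inner _ _)
  · exact (integrable_inner_mul_inner _ _).const_mul 2

/-- A ball of radius `2 t R` around a point of the support carries mass at least `t ^ d`. -/
lemma pow_le_covariateLaw_closedBall {d : ℕ} {x : E d} (hx : ‖x‖ ≤ radius d) {t : ℝ} (ht : 0 ≤ t)
    (ht1 : t ≤ 1) :
    ENNReal.ofReal (t ^ d) ≤ covariateLaw d (Metric.closedBall x (2 * radius d * t)) := by
  have hR := radius_pos d
  have hB := Metric.measure_closedBall_pos volume (0 : E d) hR
  rw [covariateLaw_eq, Measure.smul_apply, Measure.restrict_apply' Metric.isClosed_closedBall.measurableSet,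
    smul_eq_mul]
  -- The image of the whole support under the contraction by t towards x stays in the support, by
  -- convexity, and within 2tR of x; its relative volume is t^d.
  have hsub : Metric.closedBall ((1 - t) • x) (t * radius d) ⊆
      Metric.closedBall x (2 * radius d * t) ∩ Metric.closedBall 0 (radius d) := by
    refine Set.subset_inter ?_ ?_
    · refine Metric.closedBall_subset_closedBall' ?_
      have : (1 - t) • x - x = -(t • x) := by rw [sub_smul, one_smul]; abel
      rw [dist_eq_norm, this, norm_neg, norm_smul, Real.norm_of_nonneg ht]
      nlinarith [mul_le_mul_of_nonneg_left hx ht]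
    · refine Metric.closedBall_subset_closedBall' ?_
      rw [dist_zero_right, norm_smul, Real.norm_of_nonneg (by linarith)]
      nlinarith [mul_le_mul_of_nonneg_left hx (sub_nonneg.2 ht1)]
  refine le_trans ?_ (mul_le_mul_right (measure_mono hsub) _)
  rw [Measure.addHaar_closedBall_mul _ _ ht hR.le, finrank_euclideanSpace_fin, mul_comm, mul_assoc,
    ENNReal.mul_inv_cancel hB.ne' measure_closedBall_lt_top.ne, mul_one]

end Geometry

/-! ### Deterministic stability of the minimizer and fluctuation of the second-moment matrix -/

section EmpiricalRisk

variable {d n : ℕ}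

/-- The bilinear form of the empirical second-moment matrix. -/
noncomputable def empiricalForm (X : Fin n → E d) (a b : E d) : ℝ :=
  (1 / (n : ℝ)) * ∑ i, inner ℝ (X i) a * inner ℝ (X i) b

/-- The fluctuation `(Σₙ - I) θ` of the empirical second-moment matrix applied to `θ`. -/
noncomputable def momentFluctuation (θ : E d) (X : Fin n → E d) : E d :=
  (1 / (n : ℝ)) • ∑ i, (inner ℝ (X i) θ : ℝ) • X i - θ

lemma empiricalForm_self_nonneg (X : Fin n → E d) (a : E d) : 0 ≤ empiricalForm X a a :=
  mul_nonneg (by positivity) (Finset.sum_nonneg fun _ _ => mul_self_nonneg _)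

lemma empiricalForm_eq (X : Fin n → E d) (θ h : E d) :
    empiricalForm X θ h = inner ℝ (momentFluctuation θ X) h + inner ℝ θ h := by
  simp only [empiricalForm, momentFluctuation, inner_sub_left, inner_smul_left, sum_inner]
  simp

lemma empiricalRisk_eq (X : Fin n → E d) (θstar θ : E d) :
    empiricalRisk X (fun i => linearFn θstar (X i)) θ =
      empiricalForm X (θ - θstar) (θ - θstar) := by
  simp only [empiricalRisk, empiricalForm, linearFn, inner_sub_right, sq]

lemma empiricalForm_add_smul (X : Fin n → E d) (a b : E d) (s : ℝ) :
    empiricalForm X (a + s • b) (a + s • b) =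
      empiricalForm X a a + s * (2 * empiricalForm X a b + s * empiricalForm X b b) := by
  have : ∀ i, inner ℝ (X i) (a + s • b) * inner ℝ (X i) (a + s • b) =
      inner ℝ (X i) a * inner ℝ (X i) a + (s * 2 * (inner ℝ (X i) a * inner ℝ (X i) b) +
        s * s * (inner ℝ (X i) b * inner ℝ (X i) b)) := by
    intro i; rw [inner_add_right, inner_smul_right]; ring
  simp only [empiricalForm, this, Finset.sum_add_distrib, ← Finset.mul_sum]
  ring

lemma empiricalForm_sub_smul_right (X : Fin n → E d) (θ h : E d) (c : ℝ) :
    empiricalForm X (h - c • θ) (-h) = c * empiricalForm X θ h - empiricalForm X h h := by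
  have : ∀ i, inner ℝ (X i) (h - c • θ) * inner ℝ (X i) (-h) =
      c * (inner ℝ (X i) θ * inner ℝ (X i) h) - inner ℝ (X i) h * inner ℝ (X i) h := by
    intro i; rw [inner_sub_right, inner_smul_right, inner_neg_right]; ring
  simp only [empiricalForm, this, Finset.sum_sub_distrib, ← Finset.mul_sum]
  ring

/-- Extracts a first-order optimality condition from the quadratic increment of the risk along a
segment, after division by s. -/
lemma nonneg_of_forall_add_mul_nonneg {a b : ℝ} (h : ∀ s, 0 < s → s ≤ 1 → 0 ≤ a + s * b) :
    0 ≤ a := by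
  have h1 : Tendsto (fun s : ℝ => a + s * b) (𝓝[>] 0) (𝓝 a) := by
    have : Tendsto (fun s : ℝ => a + s * b) (𝓝 0) (𝓝 (a + 0 * b)) :=
      Continuous.tendsto (by fun_prop) 0
    rw [zero_mul, add_zero] at this
    exact this.mono_left nhdsWithin_le_nhds
  refine ge_of_tendsto h1 ?_
  filter_upwards [Ioc_mem_nhdsGT (zero_lt_one' ℝ)] with s hs using h s hs.1 hs.2

/-- The empirical risk minimizer is within `2 L ‖(Σₙ - I) θ⋆‖` of the population minimizer. -/
lemma IsERM.norm_sub_le {L : ℝ} (hL0 : 0 ≤ L) (hL1 : L < 1) {θstar : E d} (hθ : ‖θstar‖ = 1)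
    {θhat : (Fin n → E d) → E d} (h : IsERM L θstar θhat) (X : Fin n → E d) :
    ‖θhat X - L • θstar‖ ≤ 2 * L * ‖momentFluctuation θstar X‖ := by
  set v := θhat X - L • θstar with hv
  -- Variational inequality for the minimizer in the direction of the feasible point Lθ⋆.
  have hmin : 0 ≤ 2 * empiricalForm X (θhat X - θstar) (-v) := by
    refine nonneg_of_forall_add_mul_nonneg (b := empiricalForm X (-v) (-v)) fun s hs hs1 => ?_
    have hn : ‖θhat X + s • (-v)‖ ≤ L := by
      have : θhat X + s • (-v) = (1 - s) • θhat X + s • (L • θstar) := by rw [hv]; module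
      rw [this]
      refine (norm_add_le _ _).trans ?_
      rw [norm_smul, norm_smul, norm_smul, hθ, Real.norm_of_nonneg hs.le, Real.norm_of_nonneg hL0,
        Real.norm_of_nonneg (by linarith)]
      nlinarith [mul_le_mul_of_nonneg_left (h.norm_le X) (sub_nonneg.2 hs1)]
    have := h.isMin X _ hn
    rw [empiricalRisk_eq, empiricalRisk_eq, add_sub_right_comm, empiricalForm_add_smul] at this
    exact nonneg_of_mul_nonneg_right (by linarith) hs
  have hsub : θhat X - θstar = v - (1 - L) • θstar := by rw [hv]; module
  rw [hsub, empiricalForm_sub_smul_right, empiricalForm_eq] at hmin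
  have hself := empiricalForm_self_nonneg X v
  -- The condition reads (1-L) Σₙ(θ⋆, v) ≥ Σₙ(v, v) ≥ 0. Only positivity of Σₙ is used, so no lower
  -- bound on its eigenvalues is needed.
  have h1 : 0 ≤ inner ℝ (momentFluctuation θstar X) v + inner ℝ θstar v :=
    nonneg_of_mul_nonneg_right (a := 1 - L) (by linarith) (by linarith)
  -- This is ‖Lθ⋆ + v‖² ≤ L² expanded: the curvature comes from the constraint ball. Together with
  -- `h1` it gives ‖v‖² ≤ 2L⟨w, v⟩.
  have h2 : ‖v‖ ^ 2 + 2 * L * inner ℝ θstar v ≤ 0 := by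
    have h3 : θhat X = L • θstar + v := by rw [hv]; module
    have h4 := pow_le_pow_left₀ (norm_nonneg _) (h.norm_le X) 2
    rw [h3, norm_add_sq_real, norm_smul, hθ, inner_smul_left, Real.norm_of_nonneg hL0] at h4
    simp only [conj_trivial] at h4
    linarith
  have h5 : ‖v‖ * ‖v‖ ≤ 2 * L * ‖momentFluctuation θstar X‖ * ‖v‖ := by
    nlinarith [mul_le_mul_of_nonneg_left (real_inner_le_norm (momentFluctuation θstar X) v) hL0,
      mul_nonneg hL0 h1]
  rcases (norm_nonneg v).eq_or_lt with h0 | h0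
  · rw [← h0]; positivity
  · exact le_of_mul_le_mul_right h5 h0

lemma measurable_momentFluctuation (θ : E d) :
    Measurable (momentFluctuation (n := n) θ) := by
  unfold momentFluctuation; fun_prop

lemma ae_pi_norm_le_radius (d n : ℕ) :
    ∀ᵐ X ∂Measure.pi fun _ : Fin n => covariateLaw d, ∀ i, ‖X i‖ ≤ radius d :=
  ae_all_iff.2 fun i =>
    (measurePreserving_eval (fun _ : Fin n => covariateLaw d) i).quasiMeasurePreserving.ae
      (ae_norm_le_radius d)

/-- By identity covariance each coordinate is a centred average of n i.i.d. terms, so its second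
moment is a variance over n. -/
lemma integral_momentFluctuation_coord_sq_le (hd : 1 ≤ d) (hn : 1 ≤ n) (θ : E d) (k : Fin d) :
    MemLp (fun X => momentFluctuation θ X k) 2 (Measure.pi fun _ : Fin n => covariateLaw d) ∧
    ∫ X, momentFluctuation θ X k ^ 2 ∂(Measure.pi fun _ : Fin n => covariateLaw d) ≤
      (1 / (n : ℝ)) * ∫ x, (inner ℝ x θ * x k) ^ 2 ∂covariateLaw d := by
  have hn0 : (n : ℝ) ≠ 0 := by positivity
  set f : E d → ℝ := fun x => inner ℝ x θ * x k with hf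
  have hfm : Measurable f := by fun_prop
  have hx : ∀ x : E d, x k = inner ℝ x (EuclideanSpace.single k 1) := by
    intro x; simp [EuclideanSpace.inner_single_right]
  have hfL : MemLp f 2 (covariateLaw d) := by
    refine MemLp.of_bound hfm.aestronglyMeasurable (radius d * ‖θ‖ * radius d) ?_
    filter_upwards [ae_norm_le_radius d] with x hxR
    have := radius_pos d
    rw [hf, norm_mul]
    gcongr
    · exact (abs_real_inner_le_norm _ _).trans (by gcongr)
    · exact (PiLp.norm_apply_le x k).trans hxR
  have hmean : ∫ x, f x ∂covariateLaw d = θ k := by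
    simp only [hf, hx]
    exact integral_inner_mul_inner hd _ _
  set S : (Fin n → E d) → ℝ := ∑ i, fun X => f (X i) with hS
  have hfi : ∀ i : Fin n, MemLp (fun X : Fin n → E d => f (X i)) 2
      (Measure.pi fun _ : Fin n => covariateLaw d) := fun i =>
    hfL.comp_measurePreserving (measurePreserving_eval _ i)
  have hSL : MemLp S 2 (Measure.pi fun _ : Fin n => covariateLaw d) :=
    memLp_finsetSum' _ fun i _ => hfi i
  have hSmean : ∫ X, S X ∂(Measure.pi fun _ : Fin n => covariateLaw d) = n * θ k := by
    simp only [hS, Finset.sum_apply]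
    rw [integral_finsetSum _ fun i _ => (hfi i).integrable (by norm_num)]
    have : ∀ i : Fin n, ∫ X : Fin n → E d, f (X i) ∂(Measure.pi fun _ : Fin n => covariateLaw d)
        = θ k := fun i => by
      rw [integral_comp_eval (μ := fun _ : Fin n => covariateLaw d) hfm.aestronglyMeasurable, hmean]
    simp [this]
  have hw : ∀ X : Fin n → E d, momentFluctuation θ X k = (1 / (n : ℝ)) * (S X - n * θ k) := by
    intro X
    simp only [momentFluctuation, hS, hf, PiLp.sub_apply, PiLp.smul_apply, Finset.sum_apply,
      smul_eq_mul, WithLp.ofLp_sum, WithLp.ofLp_smul, Pi.smul_apply]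
    field_simp
  have hvar := variance_sum_pi (μ := fun _ : Fin n => covariateLaw d) (X := fun _ => f)
    fun _ => hfL
  rw [variance_eq_integral hSL.aemeasurable, hSmean] at hvar
  simp only [hw]
  refine ⟨(hSL.sub (memLp_const _)).const_mul _, ?_⟩
  simp only [mul_pow]
  rw [integral_const_mul, hvar]
  have hle := variance_le_expectation_sq (X := f) (μ := covariateLaw d) hfm.aestronglyMeasurable
  simp only [Finset.sum_const, Finset.card_univ, Fintype.card_fin, nsmul_eq_mul]
  calc (1 / (n : ℝ)) ^ 2 * (n * Var[f; covariateLaw d]) = (1 / n) * Var[f; covariateLaw d] := by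
        field_simp
    _ ≤ _ := by
        gcongr
        refine hle.trans_eq ?_
        simp [hf, mul_pow]

/-- The second moment of `(Σₙ - I) θ` is at most `(d + 2) ‖θ‖² / n`. -/
lemma integral_momentFluctuation_sq_le (hd : 1 ≤ d) (hn : 1 ≤ n) (θ : E d) :
    Integrable (fun X => ‖momentFluctuation θ X‖ ^ 2)
      (Measure.pi fun _ : Fin n => covariateLaw d) ∧
    ∫ X, ‖momentFluctuation θ X‖ ^ 2 ∂(Measure.pi fun _ : Fin n => covariateLaw d) ≤
      (d + 2) * ‖θ‖ ^ 2 / n := by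
  have h := fun k => integral_momentFluctuation_coord_sq_le hd hn θ k
  have hint := fun k => (h k).1.integrable_sq
  simp only [EuclideanSpace.real_norm_sq_eq]
  refine ⟨integrable_finsetSum _ fun k _ => hint k, ?_⟩
  rw [integral_finsetSum _ fun k _ => hint k]
  refine (Finset.sum_le_sum fun k _ => (h k).2).trans ?_
  have hR := radius_pos d
  have hi : ∀ k : Fin d, Integrable (fun x : E d => (inner ℝ x θ * x k) ^ 2) (covariateLaw d) := by
    intro k
    refine integrable_of_bound_radius (by fun_prop) ((radius d * ‖θ‖ * radius d) ^ 2)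
      fun x hx => ?_
    rw [abs_pow, abs_mul]
    gcongr
    · exact (abs_real_inner_le_norm _ _).trans (by gcongr)
    · exact (PiLp.norm_apply_le x k).trans hx
  rw [← Finset.mul_sum, ← integral_finsetSum _ fun k _ => hi k]
  -- The sum over coordinates is ⟨x,θ⟩²‖x‖², and ‖x‖² ≤ d+2 on the support reduces the fourth moment
  -- to a second moment.
  have : ∫ x : E d, ∑ k, (inner ℝ x θ * x k) ^ 2 ∂covariateLaw d ≤
      ∫ x : E d, (d + 2) * inner ℝ x θ ^ 2 ∂covariateLaw d := by
    refine integral_mono_ae (integrable_finsetSum _ fun k _ => hi k) ?_ ?_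
    · simpa only [sq] using (integrable_inner_mul_inner θ θ).const_mul ((d : ℝ) + 2)
    · filter_upwards [ae_norm_le_radius d] with x hx
      simp only [mul_pow, ← Finset.mul_sum, ← EuclideanSpace.real_norm_sq_eq]
      rw [mul_comm, ← radius_sq]
      gcongr
  rw [integral_const_mul, integral_inner_sq hd] at this
  rw [← EuclideanSpace.real_norm_sq_eq]
  calc _ ≤ (1 / (n : ℝ)) * ((d + 2) * ‖θ‖ ^ 2) := by gcongr
    _ = _ := by ring

end EmpiricalRisk

/-! ### Mean squared nearest-neighbour distance -/

section NearestNeighbor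

variable {d n : ℕ}

lemma ae_sampleLaw_norm_le_radius (d n : ℕ) :
    ∀ᵐ p ∂sampleLaw d n, (∀ i, ‖p.1 i‖ ≤ radius d) ∧ ‖p.2‖ ≤ radius d :=
  (Measure.quasiMeasurePreserving_fst.ae (ae_pi_norm_le_radius d n)).and
    (Measure.quasiMeasurePreserving_snd.ae (ae_norm_le_radius d))

lemma IsNearestNeighborRule.norm_sub_le {N : (Fin n → E d) → E d → E d}
    (hN : IsNearestNeighborRule N) {X : Fin n → E d} {x : E d} {R : ℝ} (hX : ∀ i, ‖X i‖ ≤ R)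
    (hx : ‖x‖ ≤ R) : ‖x - N X x‖ ≤ 2 * R := by
  obtain ⟨i, hi⟩ := hN.mem X x
  have := _root_.norm_sub_le x (X i)
  rw [hi]
  linarith [hX i]

lemma measurableSet_forall_lt_dist (r : ℝ) :
    MeasurableSet {p : (Fin n → E d) × E d | ∀ i, r < ‖p.1 i - p.2‖} := by
  rw [Set.ofPred_forall]
  exact MeasurableSet.iInter fun i => measurableSet_lt measurable_const (by fun_prop)

/-- The probability that no training point is within `2 t R` of the test point. -/
lemma sampleLaw_real_forall_lt_dist_le {t : ℝ} (ht : 0 ≤ t) (ht1 : t ≤ 1) :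
    (sampleLaw d n).real {p | ∀ i, 2 * radius d * t < ‖p.1 i - p.2‖} ≤
      Real.exp (-(n * t ^ d)) := by
  refine ENNReal.toReal_le_of_le_ofReal (Real.exp_nonneg _) ?_
  -- Conditionally on the test point, the n training points miss a ball of mass at least t^d
  -- independently, with probability at most (1 - t^d)^n.
  rw [sampleLaw, Measure.prod_apply_symm (measurableSet_forall_lt_dist _)]
  have hpt : ∀ᵐ x ∂covariateLaw d, Measure.pi (fun _ : Fin n => covariateLaw d)
      ((fun X => (X, x)) ⁻¹' {p : (Fin n → E d) × E d | ∀ i, 2 * radius d * t < ‖p.1 i - p.2‖}) ≤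
      ENNReal.ofReal (Real.exp (-(n * t ^ d))) := by
    filter_upwards [ae_norm_le_radius d] with x hx
    have hset : (fun X => (X, x)) ⁻¹'
        {p : (Fin n → E d) × E d | ∀ i, 2 * radius d * t < ‖p.1 i - p.2‖} =
        Set.univ.pi fun _ => (Metric.closedBall x (2 * radius d * t))ᶜ := by
      ext X; simp [dist_eq_norm]
    rw [hset, Measure.pi_pi, Finset.prod_const, Finset.card_univ, Fintype.card_fin,
      prob_compl_eq_one_sub Metric.isClosed_closedBall.measurableSet]
    have h1 : 1 - covariateLaw d (Metric.closedBall x (2 * radius d * t)) ≤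
        ENNReal.ofReal (Real.exp (-(t ^ d))) := by
      refine (tsub_le_tsub_left (pow_le_covariateLaw_closedBall hx ht ht1) _).trans ?_
      rw [← ENNReal.ofReal_one, ← ENNReal.ofReal_sub _ (by positivity)]
      exact ENNReal.ofReal_le_ofReal (Real.one_sub_le_exp_neg _)
    refine (pow_le_pow_left₀ zero_le h1 n).trans_eq ?_
    rw [← ENNReal.ofReal_pow (Real.exp_nonneg _), ← Real.exp_nat_mul, mul_neg]
  refine (lintegral_mono_ae hpt).trans ?_
  simp

lemma IsNearestNeighborRule.integrable_norm_sub_sq {N : (Fin n → E d) → E d → E d}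
    (hN : IsNearestNeighborRule N) :
    Integrable (fun p => ‖p.2 - N p.1 p.2‖ ^ 2) (sampleLaw d n) := by
  refine Integrable.of_bound (C := (2 * radius d) ^ 2)
    ((measurable_snd.sub hN.measurable).norm.pow_const 2).aestronglyMeasurable ?_
  filter_upwards [ae_sampleLaw_norm_le_radius d n] with p hp
  rw [norm_pow, norm_norm]
  exact pow_le_pow_left₀ (norm_nonneg _) (hN.norm_sub_le hp.1 hp.2) 2

/-- Split according to whether some training point lies within 2tR; if none does, the diameter 2R of
the support bounds the distance. -/
lemma IsNearestNeighborRule.integral_norm_sub_sq_le {N : (Fin n → E d) → E d → E d}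
    (hN : IsNearestNeighborRule N) {t : ℝ} (ht : 0 ≤ t) (ht1 : t ≤ 1) :
    ∫ p, ‖p.2 - N p.1 p.2‖ ^ 2 ∂sampleLaw d n ≤
      4 * (d + 2) * (t ^ 2 + Real.exp (-(n * t ^ d))) := by
  set A : Set ((Fin n → E d) × E d) := {p | ∀ i, 2 * radius d * t < ‖p.1 i - p.2‖} with hA
  have hAm : MeasurableSet A := measurableSet_forall_lt_dist _
  have hAi : Integrable (A.indicator fun _ => (1 : ℝ)) (sampleLaw d n) :=
    (integrable_const _).indicator hAm
  have hR := radius_pos d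
  calc ∫ p, ‖p.2 - N p.1 p.2‖ ^ 2 ∂sampleLaw d n
      ≤ ∫ p, (4 * (d + 2) * t ^ 2 + 4 * (d + 2) * A.indicator (fun _ => (1 : ℝ)) p)
          ∂sampleLaw d n := by
        refine integral_mono_ae hN.integrable_norm_sub_sq
          ((integrable_const _).add (hAi.const_mul _)) ?_
        filter_upwards [ae_sampleLaw_norm_le_radius d n] with p hp
        have hD := hN.norm_sub_le hp.1 hp.2
        have h0 := norm_nonneg (p.2 - N p.1 p.2)
        rw [← radius_sq]
        by_cases hpA : p ∈ A
        · simp only [Set.indicator_of_mem hpA]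
          nlinarith [pow_le_pow_left₀ h0 hD 2, mul_nonneg (sq_nonneg (radius d)) (sq_nonneg t)]
        · simp only [Set.indicator_of_notMem hpA]
          simp only [hA, Set.mem_ofPred_eq, not_forall, not_lt] at hpA
          obtain ⟨i, hi⟩ := hpA
          have h1 : ‖p.2 - N p.1 p.2‖ ≤ 2 * radius d * t := by
            rw [norm_sub_rev]; exact (hN.nearest p.1 p.2 i).trans hi
          nlinarith [pow_le_pow_left₀ h0 h1 2]
    _ = 4 * (d + 2) * (t ^ 2 + (sampleLaw d n).real A) := by
        rw [integral_add (integrable_const _) (hAi.const_mul _), integral_const, integral_const_mul,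
          integral_indicator_const _ hAm]
        simp; ring
    _ ≤ _ := by
        gcongr
        exact sampleLaw_real_forall_lt_dist_le ht ht1

/-- The mean squared nearest-neighbour distance. -/
lemma IsNearestNeighborRule.integral_norm_sub_sq_le_rpow (hd : 1 ≤ d) (hn : 2 ≤ n)
    {N : (Fin n → E d) → E d → E d} (hN : IsNearestNeighborRule N) :
    ∫ p, ‖p.2 - N p.1 p.2‖ ^ 2 ∂sampleLaw d n ≤
      36 * d ^ 2 * (Real.log ((n : ℝ) ^ (1 / (d : ℝ))) / n) ^ (1 / (d : ℝ)) := by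
  have hd1 : (1 : ℝ) ≤ d := by exact_mod_cast hd
  have hn2 : (2 : ℝ) ≤ n := by exact_mod_cast hn
  have hd0 : (0 : ℝ) < d := by linarith
  have hn0 : (0 : ℝ) < n := by linarith
  have hlog2 : (1 / 2 : ℝ) ≤ Real.log 2 := by linarith [Real.log_two_gt_d9]
  have hlogn : Real.log 2 ≤ Real.log n := Real.log_le_log two_pos hn2
  have hlognn : Real.log n ≤ n := Real.log_le_self hn0.le
  rw [Real.log_rpow hn0]
  set q : ℝ := 1 / (d : ℝ) * Real.log n with hq
  have hd1' : 1 / (d : ℝ) ≤ 1 := by rw [div_le_one hd0]; exact hd1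
  have hq0 : 1 / (2 * (d : ℝ)) ≤ q := by
    rw [hq, show 1 / (2 * (d : ℝ)) = 1 / d * (1 / 2) by field_simp]
    gcongr; linarith
  have hqpos : 0 < q := lt_of_lt_of_le (by positivity) hq0
  have hqn : q ≤ n := by
    rw [hq]; nlinarith
  -- Chosen so that n t^d = log(n)/d, which makes the exponential tail equal to n^(-1/d).
  set t : ℝ := (q / n) ^ (1 / (d : ℝ)) with htdef
  have ht0 : 0 ≤ t := by positivity
  have ht1 : t ≤ 1 := Real.rpow_le_one (by positivity) ((div_le_one hn0).2 hqn) (by positivity)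
  have htd : t ^ d = q / n := by
    rw [htdef, one_div, Real.rpow_inv_natCast_pow (by positivity) (by omega)]
  -- Since n ≥ 2 gives q ≥ 1/(2d), the factor q^(1/d) in t is at least 1/(2d).
  have hexp : Real.exp (-(n * t ^ d)) ≤ 2 * d * t := by
    have h1 : Real.exp (-(n * t ^ d)) = ((n : ℝ) ^ (1 / (d : ℝ)))⁻¹ := by
      rw [htd, mul_div_cancel₀ _ hn0.ne', Real.exp_neg, Real.rpow_def_of_pos hn0, hq, mul_comm]
    have h2 : 1 / (2 * (d : ℝ)) ≤ q ^ (1 / (d : ℝ)) :=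
      calc 1 / (2 * (d : ℝ)) = (1 / (2 * (d : ℝ))) ^ (1 : ℝ) := (Real.rpow_one _).symm
        _ ≤ (1 / (2 * (d : ℝ))) ^ (1 / (d : ℝ)) :=
          Real.rpow_le_rpow_of_exponent_ge (by positivity)
            (by rw [div_le_one (by positivity)]; linarith) hd1'
        _ ≤ q ^ (1 / (d : ℝ)) := Real.rpow_le_rpow (by positivity) hq0 (by positivity)
    rw [h1, htdef, Real.div_rpow hqpos.le hn0.le, div_eq_mul_inv (q ^ _), ← mul_assoc]
    refine le_mul_of_one_le_left (by positivity) ?_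
    rw [div_le_iff₀ (by positivity)] at h2
    linarith
  refine (hN.integral_norm_sub_sq_le ht0 ht1).trans ?_
  -- The tail is only of order t, so one power of t is given up here; this is why the rate has
  -- exponent 1/d and not 2/d.
  have h3 : t ^ 2 ≤ d * t := by nlinarith
  calc 4 * ((d : ℝ) + 2) * (t ^ 2 + Real.exp (-(n * t ^ d)))
      ≤ 4 * (d + 2 * d) * (d * t + 2 * d * t) := by gcongr; linarith
    _ = _ := by ring

end NearestNeighbor

/-! ### Risk of ResMem and of the base predictor -/

section Risk

variable {d n : ℕ}

lemma measurable_linearFn {α : Type*} [MeasurableSpace α] {f g : α → E d} (hf : Measurable f)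
    (hg : Measurable g) : Measurable fun a => linearFn (f a) (g a) := by
  unfold linearFn; exact hg.inner hf

lemma linearFn_sub_sq_le (θ θ' x : E d) :
    (linearFn θ x - linearFn θ' x) ^ 2 ≤ ‖x‖ ^ 2 * ‖θ - θ'‖ ^ 2 := by
  rw [linearFn, linearFn, ← inner_sub_right, ← mul_pow, ← sq_abs]
  exact pow_le_pow_left₀ (abs_nonneg _) (abs_real_inner_le_norm _ _) 2

/-- By linearity the error is the linear form θₙ - θ⋆ evaluated at x̃ - N(x̃). -/
lemma sqError_resMemPrediction_le (θstar : E d) (θhat : (Fin n → E d) → E d)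
    (N : (Fin n → E d) → E d → E d) (p : (Fin n → E d) × E d) :
    sqError θstar (resMemPrediction θstar θhat N) p ≤
      ‖p.2 - N p.1 p.2‖ ^ 2 * ‖θhat p.1 - θstar‖ ^ 2 := by
  refine le_trans (le_of_eq ?_) (linearFn_sub_sq_le (θhat p.1) θstar (p.2 - N p.1 p.2))
  simp only [sqError, resMemPrediction, basePrediction, linearFn, inner_sub_left]
  ring

lemma IsERM.norm_sub_sq_le {L : ℝ} (hL1 : L < 1) {θstar : E d} (hθ : ‖θstar‖ = 1)
    {θhat : (Fin n → E d) → E d} (h : IsERM L θstar θhat) (X : Fin n → E d) :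
    ‖θhat X - θstar‖ ^ 2 ≤ 4 := by
  have := _root_.norm_sub_le (θhat X) θstar
  have h1 := h.norm_le X
  nlinarith [norm_nonneg (θhat X - θstar)]

lemma IsERM.norm_sub_le_add {L : ℝ} (hL0 : 0 ≤ L) (hL1 : L < 1) {θstar : E d} (hθ : ‖θstar‖ = 1)
    {θhat : (Fin n → E d) → E d} (h : IsERM L θstar θhat) (X : Fin n → E d) :
    ‖θhat X - θstar‖ ≤ 2 * L * ‖momentFluctuation θstar X‖ + (1 - L) := by
  have h1 : θhat X - θstar = (θhat X - L • θstar) - (1 - L) • θstar := by module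
  rw [h1]
  refine (_root_.norm_sub_le _ _).trans ?_
  rw [norm_smul, hθ, Real.norm_of_nonneg (by linarith), mul_one]
  linarith [h.norm_sub_le hL0 hL1 hθ X]

lemma integrable_sqError_resMemPrediction {L : ℝ} (hL1 : L < 1) {θstar : E d}
    (hθ : ‖θstar‖ = 1) {θhat : (Fin n → E d) → E d} (h : IsERM L θstar θhat)
    {N : (Fin n → E d) → E d → E d} (hN : IsNearestNeighborRule N) :
    Integrable (sqError θstar (resMemPrediction θstar θhat N)) (sampleLaw d n) := by
  have hh : Measurable fun p : (Fin n → E d) × E d => θhat p.1 := h.measurable.comp measurable_fst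
  refine (hN.integrable_norm_sub_sq.mul_const 4).mono' ?_ (ae_of_all _ fun p => ?_)
  · refine Measurable.aestronglyMeasurable (Measurable.pow_const ?_ 2)
    exact ((measurable_linearFn hh measurable_snd).add
      ((measurable_linearFn measurable_const hN.measurable).sub
        (measurable_linearFn hh hN.measurable))).sub
      (measurable_linearFn measurable_const measurable_snd)
  · rw [sqError, Real.norm_of_nonneg (sq_nonneg _)]
    exact (sqError_resMemPrediction_le θstar θhat N p).trans
      (mul_le_mul_of_nonneg_left (h.norm_sub_sq_le hL1 hθ p.1) (sq_nonneg _))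

lemma risk_resMemPrediction_le (hd : 1 ≤ d) (hn : 2 ≤ n) {L : ℝ} (hL0 : 0 ≤ L) (hL1 : L < 1)
    {θstar : E d} (hθ : ‖θstar‖ = 1) {θhat : (Fin n → E d) → E d} (h : IsERM L θstar θhat)
    {N : (Fin n → E d) → E d → E d} (hN : IsNearestNeighborRule N) :
    risk θstar (resMemPrediction θstar θhat N) ≤ 288 * rate d n L := by
  have hd1 : (1 : ℝ) ≤ d := by exact_mod_cast hd
  have hn1 : (1 : ℝ) ≤ n := by exact_mod_cast (by omega : 1 ≤ n)
  obtain ⟨hwi, hw⟩ := integral_momentFluctuation_sq_le hd (by omega : 1 ≤ n) θstar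
  have hwi' : Integrable (fun p : (Fin n → E d) × E d => ‖momentFluctuation θstar p.1‖ ^ 2)
      (sampleLaw d n) := hwi.comp_fst _
  have hw' : ∫ p, ‖momentFluctuation θstar p.1‖ ^ 2 ∂sampleLaw d n ≤
      (d + 2) * ‖θstar‖ ^ 2 / n := by
    rw [sampleLaw, integral_fun_fst (f := fun X => ‖momentFluctuation θstar X‖ ^ 2)]
    simpa using hw
  have hDi := hN.integrable_norm_sub_sq
  have hD := hN.integral_norm_sub_sq_le_rpow hd hn
  set T : ℝ := (Real.log ((n : ℝ) ^ (1 / (d : ℝ))) / n) ^ (1 / (d : ℝ)) with hT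
  have hT0 : 0 ≤ T := by
    have : 0 ≤ Real.log ((n : ℝ) ^ (1 / (d : ℝ))) :=
      Real.log_nonneg (Real.one_le_rpow hn1 (by positivity))
    positivity
  -- The estimation term is in fact of order 1/n, stronger than the stated n^(-2/3).
  have hninv : (1 : ℝ) / n ≤ (n : ℝ) ^ (-(2 / 3) : ℝ) := by
    rw [one_div, ← Real.rpow_neg_one]
    exact Real.rpow_le_rpow_of_exponent_le hn1 (by norm_num)
  have hint : risk θstar (resMemPrediction θstar θhat N) ≤
      ∫ p, (32 * (d + 2) * L ^ 2 * ‖momentFluctuation θstar p.1‖ ^ 2 +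
        2 * (1 - L) ^ 2 * ‖p.2 - N p.1 p.2‖ ^ 2) ∂sampleLaw d n := by
    refine integral_mono_ae (integrable_sqError_resMemPrediction hL1 hθ h hN)
      ((hwi'.const_mul _).add (hDi.const_mul _)) ?_
    filter_upwards [ae_sampleLaw_norm_le_radius d n] with p hp
    refine (sqError_resMemPrediction_le θstar θhat N p).trans ?_
    set D := ‖p.2 - N p.1 p.2‖
    set w := ‖momentFluctuation θstar p.1‖
    have h1 : ‖θhat p.1 - θstar‖ ^ 2 ≤ 8 * L ^ 2 * w ^ 2 + 2 * (1 - L) ^ 2 := by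
      have := pow_le_pow_left₀ (norm_nonneg _) (h.norm_sub_le_add hL0 hL1 hθ p.1) 2
      nlinarith [sq_nonneg (2 * L * w - (1 - L))]
    -- D and w both depend on the training sample. In the product D²w² the distance is replaced by
    -- its deterministic bound; the nearest-neighbour rate is kept only for the (1-L)² term.
    have h2 : D ^ 2 ≤ 4 * (d + 2) := by
      have := pow_le_pow_left₀ (norm_nonneg _) (hN.norm_sub_le hp.1 hp.2) 2
      rwa [mul_pow, radius_sq, show (2 : ℝ) ^ 2 = 4 by norm_num] at this
    nlinarith [mul_le_mul_of_nonneg_left h1 (sq_nonneg D),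
      mul_le_mul_of_nonneg_right h2 (by positivity : 0 ≤ 8 * L ^ 2 * w ^ 2)]
  refine hint.trans ?_
  rw [integral_add (hwi'.const_mul _) (hDi.const_mul _), integral_const_mul, integral_const_mul]
  rw [hθ] at hw'
  calc _ ≤ 32 * (d + 2) * L ^ 2 * ((d + 2) * 1 ^ 2 / n) + 2 * (1 - L) ^ 2 * (36 * d ^ 2 * T) := by
        gcongr
    _ = 32 * (d + 2) ^ 2 * L ^ 2 * (1 / n) + 72 * (d ^ 2 * (1 - L) ^ 2 * T) := by ring
    -- From d ≥ 1, d + 2 ≤ 3d, and 32 · 9 = 288.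
    _ ≤ 32 * (d + 2 * d) ^ 2 * L ^ 2 * (n : ℝ) ^ (-(2 / 3) : ℝ) +
        288 * (d ^ 2 * (1 - L) ^ 2 * T) := by
        gcongr
        · linarith
        · norm_num
    _ = 288 * rate d n L := by rw [rate, ← hT]; ring

lemma tendsto_rate_atTop (hd : 1 ≤ d) (L : ℝ) :
    Tendsto (fun n : ℕ => rate d n L) atTop (𝓝 0) := by
  have hd0 : (0 : ℝ) < 1 / d := by positivity
  have h1 : Tendsto (fun n : ℕ => (n : ℝ) ^ (-(2 / 3) : ℝ)) atTop (𝓝 0) :=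
    (tendsto_rpow_neg_atTop (by norm_num)).comp tendsto_natCast_atTop_atTop
  have h2 : Tendsto (fun n : ℕ => Real.log ((n : ℝ) ^ (1 / (d : ℝ))) / n) atTop (𝓝 0) := by
    have h3 : Tendsto (fun n : ℕ => 1 / (d : ℝ) * (Real.log n / n)) atTop (𝓝 (1 / (d : ℝ) * 0)) :=
      (Real.isLittleO_log_id_atTop.tendsto_div_nhds_zero.comp
        tendsto_natCast_atTop_atTop).const_mul _
    rw [mul_zero] at h3
    refine h3.congr' ?_
    filter_upwards [eventually_ge_atTop 1] with n hn
    rw [Real.log_rpow (by exact_mod_cast hn), mul_div_assoc]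
  have h4 := h2.rpow_const (p := 1 / (d : ℝ)) (Or.inr hd0.le)
  rw [Real.zero_rpow hd0.ne'] at h4
  simpa [rate] using
    (h1.const_mul ((d : ℝ) ^ 2 * L ^ 2)).add (h4.const_mul ((d : ℝ) ^ 2 * (1 - L) ^ 2))

lemma integrable_sqError_basePrediction {L : ℝ} (hL1 : L < 1) {θstar : E d}
    (hθ : ‖θstar‖ = 1) {θhat : (Fin n → E d) → E d} (h : IsERM L θstar θhat) :
    Integrable (sqError θstar (basePrediction θhat)) (sampleLaw d n) := by
  have hh : Measurable fun p : (Fin n → E d) × E d => θhat p.1 := h.measurable.comp measurable_fst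
  refine Integrable.of_bound (C := radius d ^ 2 * 4) ?_ ?_
  · refine Measurable.aestronglyMeasurable (Measurable.pow_const ?_ 2)
    exact (measurable_linearFn hh measurable_snd).sub
      (measurable_linearFn measurable_const measurable_snd)
  · filter_upwards [ae_sampleLaw_norm_le_radius d n] with p hp
    rw [sqError, Real.norm_of_nonneg (sq_nonneg _)]
    refine (linearFn_sub_sq_le _ _ _).trans ?_
    have := h.norm_sub_sq_le hL1 hθ p.1
    have := hp.2
    gcongr

/-- The test point is independent of θₙ and has identity covariance, so Fubini integrates it out
exactly. -/
lemma risk_basePrediction_eq (hd : 1 ≤ d) {L : ℝ} (hL1 : L < 1) {θstar : E d}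
    (hθ : ‖θstar‖ = 1) {θhat : (Fin n → E d) → E d} (h : IsERM L θstar θhat) :
    risk θstar (basePrediction θhat) =
      ∫ X, ‖θhat X - θstar‖ ^ 2 ∂(Measure.pi fun _ : Fin n => covariateLaw d) := by
  have hi := integrable_sqError_basePrediction hL1 hθ h
  rw [risk, sampleLaw, integral_prod _ hi]
  congr 1 with X
  simp only [sqError, basePrediction, linearFn, ← inner_sub_right]
  exact integral_inner_sq hd _

lemma IsERM.integrable_norm_sub_sq {L : ℝ} (hL1 : L < 1) {θstar : E d}
    (hθ : ‖θstar‖ = 1) {θhat : (Fin n → E d) → E d} (h : IsERM L θstar θhat) :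
    Integrable (fun X => ‖θhat X - θstar‖ ^ 2) (Measure.pi fun _ : Fin n => covariateLaw d) := by
  refine Integrable.of_bound (C := 4)
    ((h.measurable.sub_const _).norm.pow_const 2).aestronglyMeasurable (ae_of_all _ fun X => ?_)
  rw [Real.norm_of_nonneg (sq_nonneg _)]
  exact h.norm_sub_sq_le hL1 hθ X

lemma le_risk_basePrediction (hd : 1 ≤ d) {L : ℝ} (hL1 : L < 1) {θstar : E d}
    (hθ : ‖θstar‖ = 1) {θhat : (Fin n → E d) → E d} (h : IsERM L θstar θhat) :
    (1 - L) ^ 2 ≤ risk θstar (basePrediction θhat) := by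
  rw [risk_basePrediction_eq hd hL1 hθ h]
  have h1 : ∫ _ : Fin n → E d, (1 - L) ^ 2 ∂(Measure.pi fun _ : Fin n => covariateLaw d) =
      (1 - L) ^ 2 := by simp
  rw [← h1]
  refine integral_mono (integrable_const _) (h.integrable_norm_sub_sq hL1 hθ) fun X => ?_
  have h2 := norm_sub_norm_le θstar (θhat X)
  rw [norm_sub_rev, hθ] at h2
  exact pow_le_pow_left₀ (by linarith) (by linarith [h.norm_le X]) 2

/-- Young's inequality with a free weight s keeps the coefficient of (1-L)² arbitrarily close to 1,
as the sharp limit requires. -/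
lemma risk_basePrediction_le (hd : 1 ≤ d) (hn : 1 ≤ n) {L : ℝ} (hL0 : 0 ≤ L) (hL1 : L < 1)
    {θstar : E d} (hθ : ‖θstar‖ = 1) {θhat : (Fin n → E d) → E d} (h : IsERM L θstar θhat)
    {s : ℝ} (hs : 0 < s) :
    risk θstar (basePrediction θhat) ≤
      (1 - L) ^ 2 + s * (1 - L) ^ 2 + (1 + s⁻¹) * (4 * L ^ 2 * ((d + 2) / n)) := by
  obtain ⟨hwi, hw⟩ := integral_momentFluctuation_sq_le hd hn θstar
  rw [hθ, one_pow, mul_one] at hw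
  rw [risk_basePrediction_eq hd hL1 hθ h]
  calc ∫ X, ‖θhat X - θstar‖ ^ 2 ∂(Measure.pi fun _ : Fin n => covariateLaw d)
      ≤ ∫ X, ((1 - L) ^ 2 + s * (1 - L) ^ 2 +
          (1 + s⁻¹) * (4 * L ^ 2) * ‖momentFluctuation θstar X‖ ^ 2)
          ∂(Measure.pi fun _ : Fin n => covariateLaw d) := by
        refine integral_mono (h.integrable_norm_sub_sq hL1 hθ)
          ((integrable_const _).add (hwi.const_mul _)) fun X => ?_
        refine (pow_le_pow_left₀ (norm_nonneg _) (h.norm_sub_le_add hL0 hL1 hθ X) 2).trans ?_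
        set w := ‖momentFluctuation θstar X‖
        have h1 : 0 ≤ s⁻¹ * (2 * L * w - s * (1 - L)) ^ 2 := by positivity
        have h2 : s⁻¹ * (2 * L * w - s * (1 - L)) ^ 2 =
            s⁻¹ * (4 * L ^ 2) * w ^ 2 - 4 * L * w * (1 - L) + s * (1 - L) ^ 2 := by
          field_simp; ring
        linarith
    _ = (1 - L) ^ 2 + s * (1 - L) ^ 2 + (1 + s⁻¹) * (4 * L ^ 2) *
          ∫ X, ‖momentFluctuation θstar X‖ ^ 2 ∂(Measure.pi fun _ : Fin n => covariateLaw d) := by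
        rw [integral_add (integrable_const _) (hwi.const_mul _), integral_const_mul]
        simp
    _ ≤ (1 - L) ^ 2 + s * (1 - L) ^ 2 + (1 + s⁻¹) * (4 * L ^ 2) * ((d + 2) / n) := by
        gcongr
    _ = _ := by rw [mul_assoc (1 + s⁻¹)]

lemma tendsto_risk_basePrediction (hd : 1 ≤ d) {L : ℝ} (hL0 : 0 ≤ L) (hL1 : L < 1)
    {θstar : E d} (hθ : ‖θstar‖ = 1) {θhat : (n : ℕ) → (Fin n → E d) → E d}
    (h : ∀ n, 1 ≤ n → IsERM L θstar (θhat n)) :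
    Tendsto (fun n : ℕ => risk θstar (basePrediction (θhat n))) atTop (𝓝 ((1 - L) ^ 2)) := by
  -- With s = n^(-1/2) the weight s and (1 + 1/s)/n = s² + s both vanish in the limit.
  set s : ℕ → ℝ := fun n => (Real.sqrt n)⁻¹ with hsdef
  have hs : Tendsto s atTop (𝓝 0) :=
    (Real.tendsto_sqrt_atTop.comp tendsto_natCast_atTop_atTop).inv_tendsto_atTop
  have hub : Tendsto (fun n => (1 - L) ^ 2 + s n * (1 - L) ^ 2 +
      (s n ^ 2 + s n) * (4 * L ^ 2 * (d + 2))) atTop (𝓝 ((1 - L) ^ 2)) := by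
    have := ((hs.mul_const ((1 - L) ^ 2)).const_add ((1 - L) ^ 2)).add
      (((hs.pow 2).add hs).mul_const (4 * L ^ 2 * ((d : ℝ) + 2)))
    simpa using this
  refine tendsto_of_tendsto_of_tendsto_of_le_of_le' tendsto_const_nhds hub ?_ ?_
  · filter_upwards [eventually_ge_atTop 1] with n hn
    exact le_risk_basePrediction hd hL1 hθ (h n hn)
  · filter_upwards [eventually_ge_atTop 1] with n hn
    have hn0 : (0 : ℝ) < n := by exact_mod_cast hn
    have hsn : 0 < s n := by positivity
    have hsq : (1 : ℝ) / n = s n ^ 2 := by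
      rw [hsdef]; simp only [inv_pow, Real.sq_sqrt hn0.le, one_div]
    refine (risk_basePrediction_le hd hn hL0 hL1 hθ (h n hn) hsn).trans_eq ?_
    rw [div_eq_mul_one_div _ (n : ℝ), hsq]
    field_simp

end Risk

end ResMem

theorem theorem1 :
    (∃ C : ℝ, 0 < C ∧
      ∀ (d n : ℕ), 1 ≤ d → 2 ≤ n →
      ∀ (L : ℝ), 0 ≤ L → L < 1 →
      ∀ (θstar : ResMem.E d), ‖θstar‖ = 1 →
      ∀ (θhat : (Fin n → ResMem.E d) → ResMem.E d), ResMem.IsERM L θstar θhat →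
      ∀ (N : (Fin n → ResMem.E d) → ResMem.E d → ResMem.E d), ResMem.IsNearestNeighborRule N →
        Integrable (ResMem.sqError θstar (ResMem.resMemPrediction θstar θhat N))
          (ResMem.sampleLaw d n) ∧
        ResMem.risk θstar (ResMem.resMemPrediction θstar θhat N) ≤ C * ResMem.rate d n L) ∧
    (∀ (d : ℕ), 1 ≤ d → ∀ (L : ℝ), 0 ≤ L → L < 1 →
      Tendsto (fun n : ℕ => ResMem.rate d n L) atTop (𝓝 0)) ∧
    (∀ (d : ℕ), 1 ≤ d → ∀ (L : ℝ), 0 ≤ L → L < 1 →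
      ∀ (θstar : ResMem.E d), ‖θstar‖ = 1 →
      ∀ (θhat : (n : ℕ) → (Fin n → ResMem.E d) → ResMem.E d),
        (∀ n, 1 ≤ n → ResMem.IsERM L θstar (θhat n)) →
        (∀ n, 1 ≤ n →
          Integrable (ResMem.sqError θstar (ResMem.basePrediction (θhat n)))
            (ResMem.sampleLaw d n) ∧
          (1 - L) ^ 2 ≤ ResMem.risk θstar (ResMem.basePrediction (θhat n))) ∧
        Tendsto (fun n : ℕ => ResMem.risk θstar (ResMem.basePrediction (θhat n))) atTop
          (𝓝 ((1 - L) ^ 2))) := by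
  refine ⟨⟨288, by norm_num, fun d n hd hn L hL0 hL1 θstar hθ θhat h N hN =>
    ⟨ResMem.integrable_sqError_resMemPrediction hL1 hθ h hN,
      ResMem.risk_resMemPrediction_le hd hn hL0 hL1 hθ h hN⟩⟩,
    fun d hd L _ _ => ResMem.tendsto_rate_atTop hd L,
    fun d hd L hL0 hL1 θstar hθ θhat h =>
      ⟨fun n hn => ⟨ResMem.integrable_sqError_basePrediction hL1 hθ (h n hn),
        ResMem.le_risk_basePrediction hd hL1 hθ (h n hn)⟩,
        ResMem.tendsto_risk_basePrediction hd hL0 hL1 hθ h⟩⟩
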